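/- Let $H:\mathbb{R}\to M_N(\mathbb{C})$ be a time-dependent Hamiltonian of period $T>0$: every $H(t)$ is Hermitian, $H(t+T)=H(t)$ for all $t$, and the entries of $H$ are locally integrable functions of $t$. Let $\Gamma\in M_N(\mathbb{C})$ be unitary with $\Gamma^2=I$ and with eigenspaces for $+1$ and $-1$ of the same dimension, and suppose that $H$ has the chiral symmetry $\Gamma H(t)\Gamma=-H(-t)$ for all $t\in\mathbb{R}$. Then there is a unique time-evolution operator generated by $H$, that is, a unique family $U(s,t)$, $s,t\in\mathbb{R}$, of matrices that is continuous in $t$ for each $s$ and satisfies $$U(s,t)=I-i\int_s^t H(\tau)\,U(s,\tau)\,d\tau\qquad(s,t\in\mathbb{R}).$$ For an invertible Hermitian matrix $X$ let $\operatorname{sig}(X)$ be the number of positive eigenvalues of $X$ minus the number of negative eigenvalues of $X$, counted with multiplicity, and write $U(T)=U(0,T)$. Then $U(T)\Gamma$ is Hermitian and invertible, and $$\tfrac12\operatorname{sig}(U(T)\Gamma)=0.$$ Moreover, $t\mapsto U(t,T-t)$, $0\le t\le T/2$, is a continuous path of unitary matrices with $\Gamma U(t,T-t)\Gamma=U(t,T-t)^\dagger$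 which ends at $U(T/2,T/2)=I$, and for every $t\in[0,T/2]$ the matrix $U(t,T-t)\Gamma$ is Hermitian and invertible with $\tfrac12\operatorname{sig}(U(t,T-t)\Gamma)=0$. -/

import Mathlib

open MeasureTheory

namespace Floquet

/-- `H` is a time-dependent Hamiltonian of period `T > 0`: each `H t` is a Hermitian matrix,
`H (t + T) = H t`, and the entries of `H` are locally integrable functions of time
(continuous and piecewise continuous drives are special cases). -/
structure IsPeriodicHamiltonian {n : Type*} (H : ℝ → Matrix n n ℂ) (T : ℝ) : Prop where
  period_pos : 0 < T
  periodic : Function.Periodic H T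
  isHermitian : ∀ t, (H t).IsHermitian
  locallyIntegrable : ∀ i j, LocallyIntegrable (fun t => H t i j) volume

/-- `U s t` is the time-evolution operator from time `s` to time `t` generated by `H`: for each
`s`, the map `t ↦ U s t` is the (continuous) solution of the Schrödinger equation
`i ∂U/∂t = H(t) U`, `U(s, s) = 1`, written in integrated form
`U(s, t) = 1 - i ∫_s^t H(τ) U(s, τ) dτ`, with the integral taken entrywise. -/
structure IsTimeEvolution {n : Type*} [Fintype n] [DecidableEq n]
    (H : ℝ → Matrix n n ℂ) (U : ℝ → ℝ → Matrix n n ℂ) : Prop where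
  continuous : ∀ s, Continuous (U s)
  schrodinger : ∀ s t i j,
    U s t i j = (1 : Matrix n n ℂ) i j - Complex.I * ∫ τ in s..t, (H τ * U s τ) i j

/-- The signature of a Hermitian matrix: the number of positive eigenvalues minus the number of
negative eigenvalues, counted with multiplicity. -/
noncomputable def sig {n : Type*} [Fintype n] [DecidableEq n]
    {X : Matrix n n ℂ} (hX : X.IsHermitian) : ℤ :=
  ((Finset.univ.filter fun i => 0 < hX.eigenvalues i).card : ℤ)
    - ((Finset.univ.filter fun i => hX.eigenvalues i < 0).card : ℤ)

/-- `Γ` is a unitary matrix with `Γ ^ 2 = 1` that is balanced: its eigenspaces for `1` and `-1`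
have the same dimension. -/
structure IsBalancedGrading {n : Type*} [Fintype n] [DecidableEq n]
    (Γ : Matrix n n ℂ) : Prop where
  unitary : Γ ∈ Matrix.unitaryGroup n ℂ
  sq_eq_one : Γ * Γ = 1
  balanced : Module.finrank ℂ (Module.End.eigenspace (Matrix.toLin' Γ) 1) =
    Module.finrank ℂ (Module.End.eigenspace (Matrix.toLin' Γ) (-1))

end Floquet

/-!
The Schrödinger equation has locally integrable coefficients, so its solutions are only absolutely
continuous. The `m`-fold iterate of the Volterra operator `y ↦ ∫_s^t A y` has norm at most
`|∫_s^t ‖A‖| ^ m / m!`, which makes the Dyson series converge and leaves no nonzero solution of the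
homogeneous equation.

Uniqueness turns every symmetry of the generator into one of the evolution: chirality gives
`Γ U(s, t) Γ = U(-s, -t)`, and with the periodicity `Γ U(s, t) Γ = U(T - s, T - t)`. Since the
generator is skew-adjoint, `U(t, s) = U(s, t)†`; hence `Γ U(t, T - t) Γ = U(t, T - t)†`, so that
`X = U(t, T - t) Γ` is a Hermitian involution, whose signature is its trace. Passing through the
half-period, `X = U(T/2, T - t) Γ U(T - t, T/2)` is similar to `Γ`, so this trace is the difference
of the dimensions of the eigenspaces of `Γ`.
-/

namespace Floquet

open Set intervalIntegral
open scoped Interval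

section Primitive

variable {E F : Type*} [NormedAddCommGroup E] [NormedAddCommGroup F]

theorem intervalIntegrable_of_locallyIntegrable {f : ℝ → E} (hf : LocallyIntegrable f volume)
    (a b : ℝ) : IntervalIntegrable f volume a b :=
  intervalIntegrable_iff.2 <|
    (hf.integrableOn_isCompact isCompact_uIcc).mono_set uIoc_subset_uIcc

theorem absolutelyContinuousOnInterval_of_norm_sub_le {Y : ℝ → E} {k : ℝ → ℝ} {a b : ℝ}
    (hk : LocallyIntegrable k volume)
    (h : ∀ s ∈ uIcc a b, ∀ t ∈ uIcc a b, ‖Y t - Y s‖ ≤ ∫ τ in Ι s t, k τ) :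
    AbsolutelyContinuousOnInterval Y a b := by
  have hki := intervalIntegrable_of_locallyIntegrable hk
  have hK := (hki a b).absolutelyContinuousOnInterval_intervalIntegral left_mem_uIcc
  rw [absolutelyContinuousOnInterval_iff] at hK ⊢
  intro ε hε
  obtain ⟨δ, hδ, hδε⟩ := hK ε hε
  refine ⟨δ, hδ, fun I hI hlt => (Finset.sum_le_sum fun i hi => ?_).trans_lt (hδε I hI hlt)⟩
  obtain ⟨hl, hr⟩ := hI.1 i hi
  rw [dist_comm, dist_comm (∫ τ in a.._, k τ), dist_eq_norm, Real.dist_eq,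
    integral_interval_sub_left (hki _ _) (hki _ _), abs_intervalIntegral_eq]
  exact (h _ hl _ hr).trans (le_abs_self _)

variable [NormedSpace ℝ E] [NormedSpace ℝ F]

/-- `Y` is an indefinite integral of the locally integrable function `y`; equivalently, `Y` is
locally absolutely continuous with derivative `y` almost everywhere. This is the sense in which
differential equations with locally integrable coefficients are solved. -/
structure IsPrimitive (Y y : ℝ → E) : Prop where
  locallyIntegrable : LocallyIntegrable y volume
  eq_add_integral : ∀ s t, Y t = Y s + ∫ τ in s..t, y τ

theorem isPrimitive_integral {y : ℝ → E} (hy : LocallyIntegrable y volume) (s : ℝ) :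
    IsPrimitive (fun t => ∫ τ in s..t, y τ) y where
  locallyIntegrable := hy
  eq_add_integral a b :=
    (integral_add_adjacent_intervals (intervalIntegrable_of_locallyIntegrable hy s a)
      (intervalIntegrable_of_locallyIntegrable hy a b)).symm

namespace IsPrimitive

variable {Y Z y z : ℝ → E}

theorem intervalIntegrable (h : IsPrimitive Y y) (a b : ℝ) : IntervalIntegrable y volume a b :=
  intervalIntegrable_of_locallyIntegrable h.locallyIntegrable a b

theorem continuous (h : IsPrimitive Y y) : Continuous Y := by
  rw [funext (h.eq_add_integral 0)]
  exact continuous_const.add (continuous_primitive h.intervalIntegrable 0)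

theorem const_add (h : IsPrimitive Y y) (c : E) : IsPrimitive (fun t => c + Y t) y where
  locallyIntegrable := h.locallyIntegrable
  eq_add_integral s t := by rw [h.eq_add_integral s t, add_assoc]

theorem sub (hY : IsPrimitive Y y) (hZ : IsPrimitive Z z) :
    IsPrimitive (Y - Z) (fun t => y t - z t) where
  locallyIntegrable := hY.locallyIntegrable.sub hZ.locallyIntegrable
  eq_add_integral s t := by
    rw [integral_sub (hY.intervalIntegrable s t) (hZ.intervalIntegrable s t), Pi.sub_apply,
      Pi.sub_apply, hY.eq_add_integral s t, hZ.eq_add_integral s t]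
    abel

theorem clm_comp [CompleteSpace E] [CompleteSpace F] (L : E →L[ℝ] F) (h : IsPrimitive Y y) :
    IsPrimitive (fun t => L (Y t)) (fun t => L (y t)) where
  locallyIntegrable x := L.integrableAtFilter_comp (h.locallyIntegrable x)
  eq_add_integral s t := by
    rw [L.intervalIntegral_comp_comm (h.intervalIntegrable s t), ← map_add, ← h.eq_add_integral]

theorem comp_neg (h : IsPrimitive Y y) : IsPrimitive (fun t => Y (-t)) (fun t => -y (-t)) where
  locallyIntegrable := by
    refine ((locallyIntegrable_map_homeomorph (Homeomorph.neg ℝ)).1 ?_).neg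
    rw [Homeomorph.coe_neg, Measure.map_neg_eq_self]
    exact h.locallyIntegrable
  eq_add_integral s t := by
    rw [intervalIntegral.integral_neg, integral_comp_neg, ← integral_symm, ← h.eq_add_integral]

theorem comp_add_right (h : IsPrimitive Y y) (c : ℝ) :
    IsPrimitive (fun t => Y (t + c)) (fun t => y (t + c)) where
  locallyIntegrable := by
    refine (locallyIntegrable_map_homeomorph (Homeomorph.addRight c)).1 ?_
    rw [Homeomorph.coe_addRight, map_add_right_eq_self]
    exact h.locallyIntegrable
  eq_add_integral s t := by
    rw [integral_comp_add_right, ← h.eq_add_integral]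

theorem norm_sub_le (h : IsPrimitive Y y) (s t : ℝ) : ‖Y t - Y s‖ ≤ ∫ τ in Ι s t, ‖y τ‖ := by
  rw [h.eq_add_integral s t, add_sub_cancel_left]
  exact norm_integral_le_integral_norm_uIoc

theorem ae_hasDerivAt [CompleteSpace E] (h : IsPrimitive Y y) :
    ∀ᵐ t, HasDerivAt Y (y t) t := by
  filter_upwards [_root_.LocallyIntegrable.ae_hasDerivAt_integral h.locallyIntegrable] with t ht
  rw [funext (h.eq_add_integral 0)]
  exact (ht 0).const_add _

theorem absolutelyContinuousOnInterval (h : IsPrimitive Y y) (a b : ℝ) :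
    AbsolutelyContinuousOnInterval Y a b :=
  absolutelyContinuousOnInterval_of_norm_sub_le
    (fun x => (h.locallyIntegrable x).norm) fun s _ t _ => h.norm_sub_le s t

end IsPrimitive

theorem isPrimitive_of_ae_hasDerivAt [CompleteSpace E] {Y y : ℝ → E}
    (hy : LocallyIntegrable y volume) (hac : ∀ a b, AbsolutelyContinuousOnInterval Y a b)
    (hderiv : ∀ᵐ t, HasDerivAt Y (y t) t) : IsPrimitive Y y := by
  refine ⟨hy, fun s t => ?_⟩
  have hI := isPrimitive_integral hy s
  obtain ⟨C, hC⟩ := ((hac s t).sub (hI.absolutelyContinuousOnInterval s t))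
    |>.const_of_ae_hasDerivAt_zero <| by
      filter_upwards [hderiv, hI.ae_hasDerivAt] with x hx hIx _
      simpa only [sub_self] using hx.sub hIx
  have hs : Y s = C := by simpa using hC s left_mem_uIcc
  rw [hs, ← hC t right_mem_uIcc, Pi.sub_apply, sub_add_cancel]

end Primitive

namespace IsPrimitive

section Ring

variable {𝔸 : Type*} [NormedRing 𝔸] [NormedAlgebra ℝ 𝔸] {Y Z y z : ℝ → 𝔸}

-- `AbsolutelyContinuousOnInterval.smul` does not apply: it needs a multiplicative norm, which
-- matrices do not have.
theorem absolutelyContinuousOnInterval_mul (hY : IsPrimitive Y y) (hZ : IsPrimitive Z z)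
    (a b : ℝ) : AbsolutelyContinuousOnInterval (fun t => Y t * Z t) a b := by
  obtain ⟨M, hM⟩ := isCompact_uIcc.exists_bound_of_continuousOn
    (hY.continuous.continuousOn (s := uIcc a b))
  obtain ⟨N, hN⟩ := isCompact_uIcc.exists_bound_of_continuousOn
    (hZ.continuous.continuousOn (s := uIcc a b))
  have hM₀ : 0 ≤ M := (norm_nonneg _).trans (hM a left_mem_uIcc)
  have hy : LocallyIntegrable (fun t => N * ‖y t‖) volume :=
    LocallyIntegrable.smul (fun x => (hY.locallyIntegrable x).norm) N
  have hz : LocallyIntegrable (fun t => M * ‖z t‖) volume :=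
    LocallyIntegrable.smul (fun x => (hZ.locallyIntegrable x).norm) M
  refine absolutelyContinuousOnInterval_of_norm_sub_le (hz.add hy) fun s hs t ht => ?_
  calc ‖Y t * Z t - Y s * Z s‖ = ‖Y t * (Z t - Z s) + (Y t - Y s) * Z s‖ := by noncomm_ring
    _ ≤ ‖Y t‖ * ‖Z t - Z s‖ + ‖Y t - Y s‖ * ‖Z s‖ :=
      norm_add_le_of_le (norm_mul_le _ _) (norm_mul_le _ _)
    _ ≤ M * (∫ τ in Ι s t, ‖z τ‖) + (∫ τ in Ι s t, ‖y τ‖) * N := by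
      gcongr
      exacts [hM t ht, hZ.norm_sub_le s t, hY.norm_sub_le s t, hN s hs]
    _ = ∫ τ in Ι s t, (M * ‖z τ‖ + N * ‖y τ‖) := by
      rw [MeasureTheory.integral_add (intervalIntegrable_of_locallyIntegrable hz s t).def'
        (intervalIntegrable_of_locallyIntegrable hy s t).def', MeasureTheory.integral_const_mul,
        MeasureTheory.integral_const_mul, mul_comm N]

theorem mul [CompleteSpace 𝔸] (hY : IsPrimitive Y y) (hZ : IsPrimitive Z z) :
    IsPrimitive (fun t => Y t * Z t) (fun t => y t * Z t + Y t * z t) := by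
  refine isPrimitive_of_ae_hasDerivAt
    ((hY.locallyIntegrable.mul_continuous hZ.continuous).add
      (hZ.locallyIntegrable.continuous_mul hY.continuous))
    (hY.absolutelyContinuousOnInterval_mul hZ) ?_
  filter_upwards [hY.ae_hasDerivAt, hZ.ae_hasDerivAt] with t hYt hZt
  exact hYt.mul hZt

end Ring

theorem pow_succ {𝔸 : Type*} [NormedCommRing 𝔸] [NormedAlgebra ℝ 𝔸] [CompleteSpace 𝔸]
    {Y y : ℝ → 𝔸} (h : IsPrimitive Y y) (m : ℕ) :
    IsPrimitive (fun t => Y t ^ (m + 1)) (fun t => (m + 1) * (y t * Y t ^ m)) := by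
  induction m with
  | zero => simpa using h
  | succ m ih =>
    convert ih.mul h using 2 with t t
    · exact _root_.pow_succ _ _
    · push_cast
      ring

end IsPrimitive

section Majorant

variable {k : ℝ → ℝ}

theorem integral_mul_integral_pow (hk : LocallyIntegrable k volume) (s t : ℝ) (m : ℕ) :
    ∫ τ in s..t, k τ * (∫ σ in s..τ, k σ) ^ m = (∫ τ in s..t, k τ) ^ (m + 1) / (m + 1) := by
  have h := ((isPrimitive_integral hk s).pow_succ m).eq_add_integral s t
  rw [integral_same, zero_pow m.succ_ne_zero, zero_add, intervalIntegral.integral_const_mul] at h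
  rw [h, mul_div_cancel_left₀ _ (by positivity)]

theorem exists_abs_integral_eq_mul (hk : ∀ τ, 0 ≤ k τ) (s t : ℝ) :
    ∃ ε : ℝ, |ε| = 1 ∧ ∀ τ ∈ uIcc s t, |∫ σ in s..τ, k σ| = ε * ∫ σ in s..τ, k σ := by
  rcases le_total s t with hst | hst
  · refine ⟨1, abs_one, fun τ hτ => ?_⟩
    rw [uIcc_of_le hst] at hτ
    rw [one_mul, abs_of_nonneg (integral_nonneg hτ.1 fun σ _ => hk σ)]
  · refine ⟨-1, by simp, fun τ hτ => ?_⟩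
    rw [uIcc_of_ge hst] at hτ
    rw [neg_one_mul, ← integral_symm, abs_integral_eq_abs_integral_uIoc, uIoc_comm,
      ← abs_integral_eq_abs_integral_uIoc, abs_of_nonneg (integral_nonneg hτ.2 fun σ _ => hk σ)]

theorem abs_integral_mul_abs_integral_pow (hk : LocallyIntegrable k volume) (hk₀ : ∀ τ, 0 ≤ k τ)
    (s t : ℝ) (m : ℕ) :
    |∫ τ in s..t, k τ * |∫ σ in s..τ, k σ| ^ m| = |∫ τ in s..t, k τ| ^ (m + 1) / (m + 1) := by
  obtain ⟨ε, hε, habs⟩ := exists_abs_integral_eq_mul hk₀ s t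
  have hcongr : ∫ τ in s..t, k τ * |∫ σ in s..τ, k σ| ^ m =
      ∫ τ in s..t, ε ^ m * (k τ * (∫ σ in s..τ, k σ) ^ m) :=
    integral_congr fun τ hτ => by
      simp only [habs τ hτ, mul_pow]
      ring
  rw [hcongr, intervalIntegral.integral_const_mul, integral_mul_integral_pow hk, abs_mul, abs_pow,
    hε, one_pow, one_mul, abs_div, abs_pow, abs_of_nonneg (by positivity : (0 : ℝ) ≤ m + 1)]

end Majorant

section Volterra

variable {𝔸 : Type*} [NormedRing 𝔸] [NormedAlgebra ℝ 𝔸] {A y : ℝ → 𝔸} {s : ℝ}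

/-- The Volterra operator `y ↦ ∫_s^t A y`. Solutions of `Y' = A Y`, `Y s = 1` are the fixed points
of `1 + volterra A s`, and the sum of its iterates at `1` is the Dyson series. -/
noncomputable def volterra (A : ℝ → 𝔸) (s : ℝ) (y : ℝ → 𝔸) (t : ℝ) : 𝔸 :=
  ∫ τ in s..t, A τ * y τ

theorem isPrimitive_volterra (hA : LocallyIntegrable A volume) (hy : Continuous y) :
    IsPrimitive (volterra A s y) (fun t => A t * y t) :=
  isPrimitive_integral (hA.mul_continuous hy) s

theorem continuous_iterate_volterra (hA : LocallyIntegrable A volume) (hy : Continuous y) (m : ℕ) :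
    Continuous ((volterra A s)^[m] y) := by
  induction m with
  | zero => exact hy
  | succ m ih =>
    rw [Function.iterate_succ_apply']
    exact (isPrimitive_volterra hA ih).continuous

theorem norm_volterra_le (hA : LocallyIntegrable A volume) {t C : ℝ} {m : ℕ} (hC : 0 ≤ C)
    (hy : ∀ τ ∈ uIcc s t, ‖y τ‖ ≤ C * (|∫ σ in s..τ, ‖A σ‖| ^ m / m.factorial)) :
    ‖volterra A s y t‖ ≤ C * (|∫ σ in s..t, ‖A σ‖| ^ (m + 1) / (m + 1).factorial) := by
  have hnorm : LocallyIntegrable (fun τ => ‖A τ‖) volume := fun x => (hA x).norm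
  have hcont := (isPrimitive_integral hnorm s).continuous
  have hbound : ∀ τ ∈ Ι s t,
      ‖A τ * y τ‖ ≤ C / m.factorial * (‖A τ‖ * |∫ σ in s..τ, ‖A σ‖| ^ m) := fun τ hτ =>
    calc ‖A τ * y τ‖ ≤ ‖A τ‖ * (C * (|∫ σ in s..τ, ‖A σ‖| ^ m / m.factorial)) :=
          norm_mul_le_of_le le_rfl (hy τ (uIoc_subset_uIcc hτ))
      _ = C / m.factorial * (‖A τ‖ * |∫ σ in s..τ, ‖A σ‖| ^ m) := by ring
  calc ‖volterra A s y t‖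
      ≤ |∫ τ in s..t, C / m.factorial * (‖A τ‖ * |∫ σ in s..τ, ‖A σ‖| ^ m)| :=
        norm_integral_le_abs_of_norm_le
          ((ae_restrict_iff' measurableSet_uIoc).2 (Filter.Eventually.of_forall hbound))
          ((intervalIntegrable_of_locallyIntegrable
            (hnorm.mul_continuous (hcont.abs.pow m)) s t).const_mul _)
    _ = C / m.factorial * (|∫ σ in s..t, ‖A σ‖| ^ (m + 1) / (m + 1)) := by
        rw [intervalIntegral.integral_const_mul, abs_mul,
          abs_integral_mul_abs_integral_pow hnorm fun _ => norm_nonneg _,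
          abs_of_nonneg (by positivity)]
    _ = C * (|∫ σ in s..t, ‖A σ‖| ^ (m + 1) / (m + 1).factorial) := by
        rw [Nat.factorial_succ]
        push_cast
        field_simp

theorem norm_iterate_volterra_le (hA : LocallyIntegrable A volume) {t C : ℝ}
    (hy : ∀ τ ∈ uIcc s t, ‖y τ‖ ≤ C) (m : ℕ) :
    ‖(volterra A s)^[m] y t‖ ≤ C * (|∫ σ in s..t, ‖A σ‖| ^ m / m.factorial) := by
  have hC : 0 ≤ C := (norm_nonneg _).trans (hy s left_mem_uIcc)
  induction m generalizing t with
  | zero => simpa using hy t right_mem_uIcc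
  | succ m ih =>
    rw [Function.iterate_succ_apply']
    exact norm_volterra_le hA hC fun τ hτ =>
      ih fun σ hσ => hy σ (uIcc_subset_uIcc left_mem_uIcc hτ hσ)

theorem eq_zero_of_isFixedPt_volterra (hA : LocallyIntegrable A volume) (hy : Continuous y)
    (hfix : Function.IsFixedPt (volterra A s) y) : y = 0 := by
  ext t
  obtain ⟨C, hC⟩ := isCompact_uIcc.exists_bound_of_continuousOn (hy.continuousOn (s := uIcc s t))
  have hle : ∀ m : ℕ, ‖y t‖ ≤ C * (|∫ σ in s..t, ‖A σ‖| ^ m / m.factorial) := fun m => by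
    simpa only [(hfix.iterate m).eq] using norm_iterate_volterra_le hA hC m
  have hlim := (FloorSemiring.tendsto_pow_div_factorial_atTop |∫ σ in s..t, ‖A σ‖|).const_mul C
  rw [mul_zero] at hlim
  exact norm_le_zero_iff.1 (ge_of_tendsto' hlim hle)

theorem exists_summable_norm_iterate_volterra_one_le (hA : LocallyIntegrable A volume)
    (s a b : ℝ) : ∃ u : ℕ → ℝ, Summable u ∧
      ∀ m, ∀ t ∈ uIcc a b, ‖(volterra A s)^[m] 1 t‖ ≤ u m := by
  have hcont := (isPrimitive_integral (fun x => (hA x).norm) s).continuous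
  obtain ⟨M, hM⟩ := isCompact_uIcc.exists_bound_of_continuousOn
    (hcont.continuousOn (s := uIcc a b))
  refine ⟨fun m => ‖(1 : 𝔸)‖ * (M ^ m / m.factorial),
    (Real.summable_pow_div_factorial M).mul_left _, fun m t ht => ?_⟩
  calc ‖(volterra A s)^[m] 1 t‖
      ≤ ‖(1 : 𝔸)‖ * (|∫ σ in s..t, ‖A σ‖| ^ m / m.factorial) :=
        norm_iterate_volterra_le hA (fun _ _ => le_rfl) m
    _ ≤ ‖(1 : 𝔸)‖ * (M ^ m / m.factorial) := by
        gcongr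
        exact hM t ht

variable [CompleteSpace 𝔸]

theorem continuous_tsum_iterate_volterra_one (hA : LocallyIntegrable A volume) (s : ℝ) :
    Continuous fun t => ∑' m, (volterra A s)^[m] 1 t := by
  refine continuous_iff_continuousAt.2 fun t => ?_
  obtain ⟨u, hu, hle⟩ := exists_summable_norm_iterate_volterra_one_le hA s (t - 1) (t + 1)
  refine (continuousOn_tsum
    (fun m => (continuous_iterate_volterra hA continuous_one m).continuousOn) hu hle)
    |>.continuousAt ?_
  rw [uIcc_of_le (by linarith)]
  exact Icc_mem_nhds (sub_one_lt t) (lt_add_one t)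

theorem tsum_iterate_volterra_one_eq (hA : LocallyIntegrable A volume) (s t : ℝ) :
    ∑' m, (volterra A s)^[m] 1 t = 1 + volterra A s (fun τ => ∑' m, (volterra A s)^[m] 1 τ) t := by
  obtain ⟨u, hu, hle⟩ := exists_summable_norm_iterate_volterra_one_le hA s s t
  have hsum : ∀ τ ∈ uIcc s t, Summable fun m => (volterra A s)^[m] 1 τ := fun τ hτ =>
    hu.of_norm_bounded fun m => hle m τ hτ
  have hint : HasSum (fun m => ∫ τ in s..t, A τ * (volterra A s)^[m] 1 τ)
      (∫ τ in s..t, A τ * ∑' m, (volterra A s)^[m] 1 τ) := by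
    refine hasSum_integral_of_dominated_convergence (fun m τ => ‖A τ‖ * u m)
      (fun m => (hA.mul_continuous
        (continuous_iterate_volterra hA continuous_one m)).aestronglyMeasurable.restrict)
      (fun m => .of_forall fun τ hτ =>
        norm_mul_le_of_le le_rfl (hle m τ (uIoc_subset_uIcc hτ)))
      (.of_forall fun τ _ => hu.mul_left _) ?_
      (.of_forall fun τ hτ => (hsum τ (uIoc_subset_uIcc hτ)).hasSum.mul_left _)
    simp only [tsum_mul_left]
    exact (intervalIntegrable_of_locallyIntegrable hA s t).norm.mul_const _
  rw [(hsum t right_mem_uIcc).tsum_eq_zero_add, volterra, ← hint.tsum_eq]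
  simp only [Function.iterate_succ_apply', volterra, Function.iterate_zero, id, Pi.one_apply]

end Volterra

section Propagator

variable {𝔸 : Type*} [NormedRing 𝔸] [NormedAlgebra ℝ 𝔸] {A : ℝ → 𝔸} {U V : ℝ → ℝ → 𝔸}

theorem IsPrimitive.eq_of_eq_mul {Y Z : ℝ → 𝔸} (hA : LocallyIntegrable A volume)
    (hY : IsPrimitive Y fun t => A t * Y t) (hZ : IsPrimitive Z fun t => A t * Z t) {s : ℝ}
    (hs : Y s = Z s) : Y = Z := by
  have hD : IsPrimitive (Y - Z) fun t => A t * (Y - Z) t := by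
    simpa only [Pi.sub_apply, mul_sub] using hY.sub hZ
  refine sub_eq_zero.1
    (eq_zero_of_isFixedPt_volterra hA hD.continuous (s := s) (funext fun t => ?_))
  rw [volterra, hD.eq_add_integral s t, Pi.sub_apply, hs, sub_self, zero_add]

/-- `U s t` is the propagator from time `s` to time `t` of the linear equation `Y' = A Y` with
locally integrable generator `A`: for each `s`, the function `U s` solves the equation with initial
value `1` at time `s`. -/
structure IsPropagator (A : ℝ → 𝔸) (U : ℝ → ℝ → 𝔸) : Prop where
  locallyIntegrable : LocallyIntegrable A volume
  self : ∀ s, U s s = 1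
  isPrimitive : ∀ s, IsPrimitive (U s) fun t => A t * U s t

theorem exists_isPropagator [CompleteSpace 𝔸] (hA : LocallyIntegrable A volume) :
    ∃ U, IsPropagator A U := by
  have hU := tsum_iterate_volterra_one_eq hA
  refine ⟨fun s t => ∑' m, (volterra A s)^[m] 1 t, hA, fun s => ?_, fun s => ?_⟩
  · rw [hU, volterra, integral_same, add_zero]
  · have hV := isPrimitive_volterra (s := s) hA (continuous_tsum_iterate_volterra_one hA s)
    simpa only [← hU] using hV.const_add 1

namespace IsPropagator

theorem unique (hU : IsPropagator A U) (hV : IsPropagator A V) : U = V :=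
  funext fun s => (hU.isPrimitive s).eq_of_eq_mul hU.locallyIntegrable (hV.isPrimitive s) <| by
    rw [hU.self, hV.self]

theorem add_period (hU : IsPropagator A U) {T : ℝ} (hT : Function.Periodic A T) (s t : ℝ) :
    U (s + T) (t + T) = U s t := by
  have hshift : IsPropagator A fun s t => U (s + T) (t + T) :=
    ⟨hU.locallyIntegrable, fun _ => hU.self _, fun s => by
      simpa only [hT _] using (hU.isPrimitive (s + T)).comp_add_right T⟩
  exact congrFun₂ (hshift.unique hU) s t

variable [CompleteSpace 𝔸]

theorem mul_eq (hU : IsPropagator A U) (r s t : ℝ) : U r t * U s r = U s t := by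
  have hmul := (hU.isPrimitive r).clm_comp ((ContinuousLinearMap.mul ℝ 𝔸).flip (U s r))
  simp only [ContinuousLinearMap.flip_apply, ContinuousLinearMap.mul_apply', mul_assoc] at hmul
  exact congrFun (hmul.eq_of_eq_mul hU.locallyIntegrable (hU.isPrimitive s) (s := r)
    (by rw [hU.self, one_mul])) t

theorem mul_symm (hU : IsPropagator A U) (s t : ℝ) : U t s * U s t = 1 := by
  rw [hU.mul_eq, hU.self]

theorem conj_neg (hU : IsPropagator A U) {Γ : 𝔸} (hΓ : Γ * Γ = 1)
    (hA : ∀ t, Γ * A t * Γ = -A (-t)) (s t : ℝ) : Γ * U s t * Γ = U (-s) (-t) := by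
  have hgen : ∀ s t, Γ * -(A (-t) * U (-s) (-t)) * Γ = A t * (Γ * U (-s) (-t) * Γ) := fun s t =>
    calc Γ * -(A (-t) * U (-s) (-t)) * Γ
        = -(Γ * A (-t) * (Γ * Γ) * U (-s) (-t) * Γ) := by rw [hΓ]; noncomm_ring
      _ = -(Γ * A (-t) * Γ) * (Γ * U (-s) (-t) * Γ) := by noncomm_ring
      _ = A t * (Γ * U (-s) (-t) * Γ) := by rw [hA, neg_neg, neg_neg]
  have hconj : IsPropagator A fun s t => Γ * U (-s) (-t) * Γ := by
    refine ⟨hU.locallyIntegrable, fun s => by rw [hU.self, mul_one, hΓ], fun s => ?_⟩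
    simpa only [ContinuousLinearMap.mulLeftRight_apply, hgen] using
      (hU.isPrimitive (-s)).comp_neg.clm_comp (ContinuousLinearMap.mulLeftRight ℝ 𝔸 Γ Γ)
  simpa only [neg_neg] using congrFun₂ (hconj.unique hU) (-s) (-t)

section Chiral

variable {Γ : 𝔸} {T : ℝ}

theorem conj_chiral (hU : IsPropagator A U) (hT : Function.Periodic A T) (hΓ : Γ * Γ = 1)
    (hA : ∀ t, Γ * A t * Γ = -A (-t)) (s t : ℝ) : Γ * U s t * Γ = U (T - s) (T - t) := by
  rw [hU.conj_neg hΓ hA, ← hU.add_period hT, neg_add_eq_sub, neg_add_eq_sub]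

theorem mul_chiral_eq (hU : IsPropagator A U) (hT : Function.Periodic A T) (hΓ : Γ * Γ = 1)
    (hA : ∀ t, Γ * A t * Γ = -A (-t)) (t : ℝ) :
    U t (T - t) * Γ = U (T / 2) (T - t) * Γ * U (T - t) (T / 2) := by
  have hhalf : Γ * U (T - t) (T / 2) * Γ = U t (T / 2) := by
    rw [hU.conj_chiral hT hΓ hA, sub_sub_cancel, sub_half]
  calc U t (T - t) * Γ = U (T / 2) (T - t) * (Γ * U (T - t) (T / 2) * Γ) * Γ := by
        rw [hhalf, hU.mul_eq]
    _ = U (T / 2) (T - t) * Γ * U (T - t) (T / 2) * (Γ * Γ) := by noncomm_ring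
    _ = U (T / 2) (T - t) * Γ * U (T - t) (T / 2) := by rw [hΓ, mul_one]

end Chiral

section Star

variable [StarRing 𝔸] [StarModule ℝ 𝔸] [ContinuousStar 𝔸]

theorem star_mul_self (hU : IsPropagator A U) (hA : ∀ t, star (A t) = -A t) (s t : ℝ) :
    star (U s t) * U s t = 1 := by
  have hstar := (hU.isPrimitive s).clm_comp (starL' ℝ : 𝔸 ≃L[ℝ] 𝔸).toContinuousLinearMap
  simpa [hU.self, hA, mul_assoc] using
    (hstar.mul (hU.isPrimitive s)).eq_add_integral s t

theorem star_eq (hU : IsPropagator A U) (hA : ∀ t, star (A t) = -A t) (s t : ℝ) :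
    star (U s t) = U t s :=
  left_inv_eq_right_inv (hU.star_mul_self hA s t) (hU.mul_symm t s)

theorem continuous_uncurry (hU : IsPropagator A U) (hA : ∀ t, star (A t) = -A t) :
    Continuous fun p : ℝ × ℝ => U p.1 p.2 := by
  have hcont := (hU.isPrimitive 0).continuous
  have hfac : ∀ p : ℝ × ℝ, U p.1 p.2 = U 0 p.2 * star (U 0 p.1) := fun p => by
    rw [hU.star_eq hA, hU.mul_eq]
  rw [funext hfac]
  exact (hcont.comp continuous_snd).mul (hcont.comp continuous_fst).star

end Star

end IsPropagator

end Propagator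

section Matrix

open scoped Matrix.Norms.L2Operator

variable {n : Type*} [Fintype n] [DecidableEq n]

theorem integral_matrix_apply {F : ℝ → Matrix n n ℂ} {s t : ℝ}
    (hF : IntervalIntegrable F volume s t) (i j : n) :
    (∫ τ in s..t, F τ) i j = ∫ τ in s..t, F τ i j :=
  ((Matrix.entryLinearMap ℝ ℂ i j).toContinuousLinearMap.intervalIntegral_comp_comm hF).symm

theorem locallyIntegrable_matrix {F : ℝ → Matrix n n ℂ}
    (hF : ∀ i j, LocallyIntegrable (fun t => F t i j) volume) : LocallyIntegrable F volume := by
  let single (i j : n) : ℂ →L[ℝ] Matrix n n ℂ :=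
    (Matrix.singleLinearMap ℝ i j).toContinuousLinearMap
  have hsum : F = fun t => ∑ i, ∑ j, single i j (F t i j) :=
    funext fun t => Matrix.matrix_eq_sum_single (F t)
  rw [hsum]
  exact locallyIntegrable_finsetSum _ fun i _ => locallyIntegrable_finsetSum _ fun j _ x =>
    (single i j).integrableAtFilter_comp (hF i j x)

variable {H : ℝ → Matrix n n ℂ} {U : ℝ → ℝ → Matrix n n ℂ}

theorem one_add_integral_schrodinger_apply (hH : LocallyIntegrable H volume) {y : ℝ → Matrix n n ℂ}
    (hy : Continuous y) (s t : ℝ) (i j : n) :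
    (1 + ∫ τ in s..t, (-Complex.I) • H τ * y τ) i j =
      (1 : Matrix n n ℂ) i j - Complex.I * ∫ τ in s..t, (H τ * y τ) i j := by
  have hint := intervalIntegrable_of_locallyIntegrable (hH.mul_continuous hy) s t
  simp only [Matrix.smul_mul]
  rw [intervalIntegral.integral_smul, Matrix.add_apply, Matrix.smul_apply,
    integral_matrix_apply hint, smul_eq_mul, neg_mul, ← sub_eq_add_neg]

theorem IsTimeEvolution.self (hU : IsTimeEvolution H U) (s : ℝ) : U s s = 1 := by
  ext i j
  rw [hU.schrodinger, integral_same, mul_zero, sub_zero]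

theorem IsTimeEvolution.isPropagator (hH : LocallyIntegrable H volume) (hU : IsTimeEvolution H U) :
    IsPropagator (fun t => (-Complex.I) • H t) U := by
  have hgen : LocallyIntegrable (fun t => (-Complex.I) • H t) volume := hH.smul (-Complex.I)
  have heq : ∀ s t, U s t = 1 + volterra (fun t => (-Complex.I) • H t) s (U s) t := fun s t => by
    ext i j
    rw [volterra, one_add_integral_schrodinger_apply hH (hU.continuous s), hU.schrodinger]
  refine ⟨hgen, hU.self, fun s => ?_⟩
  simpa only [← heq] using (isPrimitive_volterra (s := s) hgen (hU.continuous s)).const_add 1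

theorem IsPropagator.isTimeEvolution (hH : LocallyIntegrable H volume)
    (hU : IsPropagator (fun t => (-Complex.I) • H t) U) : IsTimeEvolution H U where
  continuous s := (hU.isPrimitive s).continuous
  schrodinger s t i j := by
    rw [← one_add_integral_schrodinger_apply hH (hU.isPrimitive s).continuous,
      (hU.isPrimitive s).eq_add_integral s t, hU.self]

theorem existsUnique_isTimeEvolution (hH : LocallyIntegrable H volume) :
    ∃! U, IsTimeEvolution H U := by
  obtain ⟨U, hU⟩ := exists_isPropagator (hH.smul (-Complex.I))
  exact ⟨U, hU.isTimeEvolution hH, fun V hV => (hV.isPropagator hH).unique hU⟩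

theorem IsPeriodicHamiltonian.isPropagator {T : ℝ} (hH : IsPeriodicHamiltonian H T)
    (hU : IsTimeEvolution H U) : IsPropagator (fun t => (-Complex.I) • H t) U :=
  hU.isPropagator (locallyIntegrable_matrix hH.locallyIntegrable)

end Matrix

section Signature

theorem trace_eq_finrank_eigenspace_sub {K V : Type*} [Field K] [NeZero (2 : K)] [AddCommGroup V]
    [Module K V] [FiniteDimensional K V] {f : Module.End K V} (hf : f * f = 1) :
    LinearMap.trace K V f =
      Module.finrank K (f.eigenspace 1) - Module.finrank K (f.eigenspace (-1)) := by
  have h2 : (2 : K) ≠ 0 := two_ne_zero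
  have htrace : ∀ ε : K, ε * ε = 1 → 2⁻¹ * (Module.finrank K V + ε * LinearMap.trace K V f) =
      Module.finrank K (f.eigenspace ε) := fun ε hε => by
    have hproj : LinearMap.IsProj (f.eigenspace ε) ((2⁻¹ : K) • (1 + ε • f)) := by
      refine ⟨fun x => ?_, fun x hx => ?_⟩
      · have hfx : f (f x) = x := LinearMap.congr_fun hf x
        simp only [Module.End.mem_eigenspace_iff, LinearMap.smul_apply, LinearMap.add_apply,
          Module.End.one_apply, map_smul, map_add, hfx, smul_comm ε (2⁻¹ : K), smul_add,
          smul_smul ε ε, hε, one_smul, add_comm]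
      · rw [Module.End.mem_eigenspace_iff] at hx
        rw [LinearMap.smul_apply, LinearMap.add_apply, LinearMap.smul_apply, hx, smul_smul, hε,
          one_smul, Module.End.one_apply, ← two_smul K x, inv_smul_smul₀ h2]
    simpa [mul_add] using hproj.trace
  rw [← htrace 1 (by ring), ← htrace (-1) (by ring)]
  field_simp
  ring

variable {n : Type*} [Fintype n] [DecidableEq n] {X : Matrix n n ℂ}

theorem eigenvalues_eq_one_or_neg_one (hX : X.IsHermitian) (hX₂ : X * X = 1) (i : n) :
    hX.eigenvalues i = 1 ∨ hX.eigenvalues i = -1 := by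
  have hmem := spectrum.pow_mem_pow X 2 (hX.eigenvalues_mem_spectrum_real i)
  have : Nonempty n := ⟨i⟩
  rw [pow_two X, hX₂, spectrum.one_eq] at hmem
  exact mul_self_eq_one_iff.1 ((pow_two _).symm.trans hmem)

theorem sig_eq_trace (hX : X.IsHermitian) (hX₂ : X * X = 1) : (sig hX : ℂ) = X.trace := by
  rw [hX.trace_eq_sum_eigenvalues, sig, Finset.card_filter, Finset.card_filter]
  push_cast
  rw [← Finset.sum_sub_distrib]
  refine Finset.sum_congr rfl fun i _ => ?_
  rcases eigenvalues_eq_one_or_neg_one hX hX₂ i with h | h <;> rw [h] <;> norm_num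

variable {Γ : Matrix n n ℂ}

theorem sig_eq_finrank_eigenspace_sub (hX : X.IsHermitian) (hX₂ : X * X = 1) (hΓ : Γ * Γ = 1)
    (htrace : X.trace = Γ.trace) :
    sig hX = (Module.finrank ℂ (Module.End.eigenspace (Matrix.toLin' Γ) 1) : ℤ) -
      Module.finrank ℂ (Module.End.eigenspace (Matrix.toLin' Γ) (-1)) := by
  have hinv : Matrix.toLin' Γ * Matrix.toLin' Γ = 1 := by
    rw [Module.End.mul_eq_comp, ← Matrix.toLin'_mul, hΓ, Matrix.toLin'_one, Module.End.one_eq_id]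
  have hcast : (sig hX : ℂ) = Γ.trace := (sig_eq_trace hX hX₂).trans htrace
  rw [← Matrix.trace_toLin'_eq, trace_eq_finrank_eigenspace_sub hinv] at hcast
  exact_mod_cast hcast

theorem conjTranspose_eq_self_of_mem_unitaryGroup (hΓ : Γ ∈ Matrix.unitaryGroup n ℂ)
    (hΓ₂ : Γ * Γ = 1) : Γ.conjTranspose = Γ :=
  left_inv_eq_right_inv (Matrix.mem_unitaryGroup_iff'.1 hΓ) hΓ₂

end Signature

section ChiralInvolution

variable {R : Type*} [Monoid R] [StarMul R] {Γ u : R}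

theorem isSelfAdjoint_mul_of_conj_eq_star (hΓ : IsSelfAdjoint Γ) (hΓ₂ : Γ * Γ = 1)
    (hu : Γ * u * Γ = star u) : IsSelfAdjoint (u * Γ) := by
  rw [isSelfAdjoint_iff, star_mul, hΓ.star_eq, ← hu, ← mul_assoc, ← mul_assoc, hΓ₂, one_mul]

theorem mul_mul_self_eq_one_of_conj_eq_star (hu : Γ * u * Γ = star u) (hmul : u * star u = 1) :
    u * Γ * (u * Γ) = 1 := by
  rw [mul_assoc, ← mul_assoc Γ, hu, hmul]

end ChiralInvolution

section Evolution

open scoped Matrix.Norms.L2Operator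

variable {n : Type*} [Fintype n] [DecidableEq n] {H : ℝ → Matrix n n ℂ}
  {U : ℝ → ℝ → Matrix n n ℂ} {Γ : Matrix n n ℂ} {T : ℝ}

namespace IsPeriodicHamiltonian

theorem star_generator {m : Type*} {H : ℝ → Matrix m m ℂ} {T : ℝ} (hH : IsPeriodicHamiltonian H T)
    (t : ℝ) : star ((-Complex.I) • H t) = -((-Complex.I) • H t) := by
  rw [star_smul, Matrix.star_eq_conjTranspose, (hH.isHermitian t).eq]
  simp

theorem evolution_mem_unitaryGroup (hH : IsPeriodicHamiltonian H T) (hU : IsTimeEvolution H U)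
    (s t : ℝ) : U s t ∈ Matrix.unitaryGroup n ℂ :=
  Matrix.mem_unitaryGroup_iff'.2 ((hH.isPropagator hU).star_mul_self hH.star_generator s t)

theorem continuous_uncurry_evolution (hH : IsPeriodicHamiltonian H T) (hU : IsTimeEvolution H U) :
    Continuous fun p : ℝ × ℝ => U p.1 p.2 :=
  (hH.isPropagator hU).continuous_uncurry hH.star_generator

theorem conj_evolution_eq (hH : IsPeriodicHamiltonian H T) (hU : IsTimeEvolution H U)
    (hΓ : Γ * Γ = 1) (chiral : ∀ t, Γ * H t * Γ = -H (-t)) (t : ℝ) :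
    Γ * U t (T - t) * Γ = (U t (T - t)).conjTranspose := by
  have hP := hH.isPropagator hU
  rw [hP.conj_chiral (hH.periodic.comp _) hΓ (fun t => by simp [chiral]), sub_sub_cancel,
    ← Matrix.star_eq_conjTranspose, hP.star_eq hH.star_generator]

theorem trace_evolution_mul (hH : IsPeriodicHamiltonian H T) (hU : IsTimeEvolution H U)
    (hΓ : Γ * Γ = 1) (chiral : ∀ t, Γ * H t * Γ = -H (-t)) (t : ℝ) :
    (U t (T - t) * Γ).trace = Γ.trace := by
  have hP := hH.isPropagator hU
  rw [hP.mul_chiral_eq (hH.periodic.comp _) hΓ (fun t => by simp [chiral]),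
    Matrix.trace_mul_comm, ← mul_assoc, hP.mul_symm, one_mul]

theorem exists_sig_evolution_mul_eq (hH : IsPeriodicHamiltonian H T) (hU : IsTimeEvolution H U)
    (hΓ : Γ ∈ Matrix.unitaryGroup n ℂ) (hΓ₂ : Γ * Γ = 1)
    (chiral : ∀ t, Γ * H t * Γ = -H (-t)) (t : ℝ) :
    ∃ hX : (U t (T - t) * Γ).IsHermitian, IsUnit (U t (T - t) * Γ) ∧
      sig hX = (Module.finrank ℂ (Module.End.eigenspace (Matrix.toLin' Γ) 1) : ℤ) -
        Module.finrank ℂ (Module.End.eigenspace (Matrix.toLin' Γ) (-1)) := by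
  have hconj := hH.conj_evolution_eq hU hΓ₂ chiral t
  have hX : (U t (T - t) * Γ).IsHermitian := isSelfAdjoint_mul_of_conj_eq_star
    (conjTranspose_eq_self_of_mem_unitaryGroup hΓ hΓ₂) hΓ₂ hconj
  have hX₂ : U t (T - t) * Γ * (U t (T - t) * Γ) = 1 := mul_mul_self_eq_one_of_conj_eq_star hconj
    (Matrix.mem_unitaryGroup_iff.1 (hH.evolution_mem_unitaryGroup hU _ _))
  exact ⟨hX, .of_mul_eq_one _ hX₂,
    sig_eq_finrank_eigenspace_sub hX hX₂ hΓ₂ (hH.trace_evolution_mul hU hΓ₂ chiral t)⟩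

end IsPeriodicHamiltonian

end Evolution

end Floquet

theorem mainTheorem8_general {n : Type*} [Fintype n] [DecidableEq n] {T : ℝ}
    {H : ℝ → Matrix n n ℂ} (hH : Floquet.IsPeriodicHamiltonian H T) {Γ : Matrix n n ℂ}
    (hΓ : Γ ∈ Matrix.unitaryGroup n ℂ) (hΓ₂ : Γ * Γ = 1) (chiral : ∀ t, Γ * H t * Γ = -H (-t)) :
    (∃! U : ℝ → ℝ → Matrix n n ℂ, Floquet.IsTimeEvolution H U) ∧
    ∀ U : ℝ → ℝ → Matrix n n ℂ, Floquet.IsTimeEvolution H U →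
      Continuous (fun t => U t (T - t)) ∧
      U (T / 2) (T - T / 2) = 1 ∧
      ∀ t : ℝ,
        U t (T - t) ∈ Matrix.unitaryGroup n ℂ ∧
        Γ * U t (T - t) * Γ = (U t (T - t)).conjTranspose ∧
        ∃ hX : (U t (T - t) * Γ).IsHermitian, IsUnit (U t (T - t) * Γ) ∧
          Floquet.sig hX =
            (Module.finrank ℂ (Module.End.eigenspace (Matrix.toLin' Γ) 1) : ℤ) -
              Module.finrank ℂ (Module.End.eigenspace (Matrix.toLin' Γ) (-1)) := by
  refine ⟨Floquet.existsUnique_isTimeEvolution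
    (Floquet.locallyIntegrable_matrix hH.locallyIntegrable), fun U hU => ⟨?_, ?_, fun t => ?_⟩⟩
  · exact (hH.continuous_uncurry_evolution hU).comp (by fun_prop : Continuous fun t => (t, T - t))
  · rw [sub_half, hU.self]
  · exact ⟨hH.evolution_mem_unitaryGroup hU _ _, hH.conj_evolution_eq hU hΓ₂ chiral t,
      hH.exists_sig_evolution_mul_eq hU hΓ hΓ₂ chiral t⟩

theorem mainTheorem8 {n : Type*} [Fintype n] [DecidableEq n]
    (T : ℝ) (H : ℝ → Matrix n n ℂ) (hH : Floquet.IsPeriodicHamiltonian H T)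
    (Γ : Matrix n n ℂ) (hΓ : Floquet.IsBalancedGrading Γ)
    (chiral : ∀ t, Γ * H t * Γ = -H (-t)) :
    (∃! U : ℝ → ℝ → Matrix n n ℂ, Floquet.IsTimeEvolution H U) ∧
    ∀ U : ℝ → ℝ → Matrix n n ℂ, Floquet.IsTimeEvolution H U →
      (∃ hX : (U 0 T * Γ).IsHermitian,
        IsUnit (U 0 T * Γ) ∧ (1 / 2 : ℚ) * (Floquet.sig hX : ℚ) = 0) ∧
      ContinuousOn (fun t => U t (T - t)) (Set.Icc 0 (T / 2)) ∧
      U (T / 2) (T - T / 2) = 1 ∧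
      ∀ t ∈ Set.Icc 0 (T / 2),
        U t (T - t) ∈ Matrix.unitaryGroup n ℂ ∧
        Γ * U t (T - t) * Γ = (U t (T - t)).conjTranspose ∧
        ∃ hX : (U t (T - t) * Γ).IsHermitian,
          IsUnit (U t (T - t) * Γ) ∧ (1 / 2 : ℚ) * (Floquet.sig hX : ℚ) = 0 := by
  have h := mainTheorem8_general hH hΓ.unitary hΓ.sq_eq_one chiral
  simp only [hΓ.balanced, sub_self] at h
  simp only [mul_eq_zero, one_div_ne_zero (two_ne_zero' ℚ), false_or, Int.cast_eq_zero]
  refine ⟨h.1, fun U hU => ?_⟩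
  obtain ⟨hcont, hhalf, hpath⟩ := h.2 U hU
  exact ⟨by simpa only [sub_zero] using (hpath 0).2.2, hcont.continuousOn, hhalf,
    fun t _ => hpath t⟩
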